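/- Let $A$ be a commutative ring with $1$. Let $E_{12}(a)=\begin{pmatrix}1&a\\0&1\end{pmatrix}$ and $E_{21}(a)=\begin{pmatrix}1&0\\a&1\end{pmatrix}$, let $\mathrm{E}_2(A)\subseteq \mathrm{GL}_2(A)$ be the subgroup generated by all $E_{ij}(a)$, let $\mathrm{GE}_2(A)\subseteq \mathrm{GL}_2(A)$ be the subgroup generated by $\mathrm{E}_2(A)$ and the invertible diagonal matrices, and put $\mathrm{PGE}_2(A)=\mathrm{GE}_2(A)/A^\times I_2$, $\mathrm{PGL}_2(A)=\mathrm{GL}_2(A)/A^\times I_2$. Let $\mathcal G_A=A^\times/(A^\times)^2$ and $A_{A^\times}=A/\langle a-1: a\in A^\times\rangle$ (quotient by the ideal generated by the elements $a-1$). The Steinberg group $\mathrm{St}(2,A)$ has generators $x_{12}(r),x_{21}(r)$ $(r\in A)$ and relations, for $\{i,j\}=\{1,2\}$, $x_{ij}(r)x_{ij}(s)=x_{ij}(r+s)$ for $r,s\in A$, and $w_{ij}(u)x_{ji}(r)w_{ij}(u)^{-1}=x_{ij}(-u^2r)$ for $u\in A^\times$, $r\in A$, where $w_{ij}(u)=x_{ij}(u)x_{ji}(-u^{-1})x_{ij}(u)$.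 Let $\mathrm K_2(2,A)$ be the kernel of $\mathrm{St}(2,A)\to \mathrm{E}_2(A)$, $x_{ij}(r)\mapsto E_{ij}(r)$, and let $h_{ij}(u)=w_{ij}(u)w_{ij}(-1)$ for $u\in A^\times$. The Steinberg symbols are the elements $\{u,v\}=h_{12}(uv)h_{12}(u)^{-1}h_{12}(v)^{-1}$ with $u,v\in A^\times$. The Dennis–Stein symbols are the elements $$\langle a,b\rangle_{ij}=x_{ji}\Big(\frac{-b}{1-ab}\Big)x_{ij}(-a)\,x_{ji}(b)\,x_{ij}\Big(\frac{a}{1-ab}\Big)h_{ij}(1-ab)^{-1}$$ with $\{i,j\}=\{1,2\}$, $a,b\in A$ and $1-ab\in A^\times$. All these symbols lie in $\mathrm K_2(2,A)$. The ring $A$ is called a universal $\mathrm{GE}_2$-ring if $\mathrm{GE}_2(A)=\mathrm{GL}_2(A)$ and $\mathrm K_2(2,A)$ is generated by Steinberg symbols. 1. If $\mathrm K_2(2,A)$ is generated by Dennis–Stein symbols, then $H_1(\mathrm{PGE}_2(A),\mathbb Z)\cong \mathcal G_A\oplus A_{A^\times}$. 2. In particular, if $A$ is a universal $\mathrm{GE}_2$-ring,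 then $H_1(\mathrm{PGE}_2(A),\mathbb Z)\cong\mathcal G_A\oplus A_{A^\times}$ and $H_1(\mathrm{PGL}_2(A),\mathbb Z)\cong \mathcal G_A\oplus A_{A^\times}$. 3. If $A$ is a local ring whose residue field does not have exactly two elements, then $H_1(\mathrm{PGL}_2(A),\mathbb Z)\cong \mathcal G_A$. 4. $H_1(\mathrm{PGL}_2(\mathbb Z),\mathbb Z)\cong \mathbb Z/2\oplus\mathbb Z/2$. -/

import Mathlib

universe u

/-- The first integral homology group `H₁(G, ℤ)`: Mathlib's group homology of the trivial
representation. The coefficient ring is lifted to the universe of `G`, because Mathlib's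
`groupHomology` asks for the ring and the group in the same universe. -/
noncomputable abbrev IntegralH1 (G : Type u) [Group G] : Type u :=
  groupHomology (Rep.trivial (ULift.{u} ℤ) G (ULift.{u} ℤ)) 1

section GE

variable (A : Type u) [CommRing A]

/-- The square class group `𝒢_A = Aˣ / (Aˣ)²`. -/
abbrev SquareClassGroup : Type u := Aˣ ⧸ (powMonoidHom 2 : Aˣ →* Aˣ).range

/-- `A_{Aˣ} = A / ⟨a - 1 : a ∈ Aˣ⟩`, the quotient of `A` by the ideal generated by the elements
`a - 1`, that is, the additive group of coinvariants of the multiplication action of `Aˣ` on `A`. -/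
abbrev UnitCoinvariants : Type u := A ⧸ Ideal.span {x : A | ∃ a : Aˣ, x = (a : A) - 1}

variable {A}

/-- The elementary matrices. Here and below the index `i : Fin 2` stands for the ordered pair of
indices `(i, i + 1)` mod 2: `elemMat 0 r = E₁₂(r)` and `elemMat 1 r = E₂₁(r)`. -/
def elemMat (i : Fin 2) (r : A) : Matrix.GeneralLinearGroup (Fin 2) A :=
  match i with
  | 0 => ⟨!![1, r; 0, 1], !![1, -r; 0, 1],
      by simp [Matrix.one_fin_two], by simp [Matrix.one_fin_two]⟩
  | 1 => ⟨!![1, 0; r, 1], !![1, 0; -r, 1],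
      by simp [Matrix.one_fin_two], by simp [Matrix.one_fin_two]⟩

variable (A)

/-- `E₂(A)`, the subgroup of `GL₂(A)` generated by the elementary matrices. -/
def E2 : Subgroup (Matrix.GeneralLinearGroup (Fin 2) A) :=
  Subgroup.closure {g | ∃ (i : Fin 2) (r : A), g = elemMat i r}

/-- `D₂(A)`, the subgroup of `GL₂(A)` generated by the (invertible) diagonal matrices. -/
def D2 : Subgroup (Matrix.GeneralLinearGroup (Fin 2) A) :=
  Subgroup.closure {g | (g : Matrix (Fin 2) (Fin 2) A).IsDiag}

/-- `GE₂(A)`, the subgroup of `GL₂(A)` generated by `D₂(A)` and `E₂(A)`. -/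
def GE2 : Subgroup (Matrix.GeneralLinearGroup (Fin 2) A) := D2 A ⊔ E2 A

/-- `PGE₂(A) = GE₂(A) / Z`, where `Z = Aˣ I₂` is the centre of `GL₂(A)`
(`Matrix.GeneralLinearGroup.center_eq_range_scalar`). -/
abbrev PGE2 : Type u :=
  GE2 A ⧸ (Subgroup.center (Matrix.GeneralLinearGroup (Fin 2) A)).subgroupOf (GE2 A)

/-- `A` is a `GE₂`-ring if `GE₂(A) = GL₂(A)`. -/
def IsGE2Ring : Prop := GE2 A = ⊤

end GE

section Steinberg

variable {A : Type u} [CommRing A]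

/-- The words `x_{ij}(r)` in the free group, with `i : Fin 2` standing for `(i, i + 1)`. -/
def freeX (i : Fin 2) (r : A) : FreeGroup (Fin 2 × A) := FreeGroup.of (i, r)

/-- The words `w_{ij}(a) = x_{ij}(a) x_{ji}(-a⁻¹) x_{ij}(a)` in the free group. -/
def freeW (i : Fin 2) (a : Aˣ) : FreeGroup (Fin 2 × A) :=
  freeX i (a : A) * freeX (i + 1) (-((a⁻¹ : Aˣ) : A)) * freeX i (a : A)

variable (A)

/-- The two families of defining relations of the Steinberg group. -/
def steinbergRels : Set (FreeGroup (Fin 2 × A)) :=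
  {z | ∃ (i : Fin 2) (r s : A), z = freeX i r * freeX i s * (freeX i (r + s))⁻¹} ∪
  {z | ∃ (i : Fin 2) (a : Aˣ) (r : A),
    z = freeW i a * freeX (i + 1) r * (freeW i a)⁻¹ * (freeX i (-((a : A) ^ 2 * r)))⁻¹}

/-- The Steinberg group `St(2, A)`. -/
abbrev St2 : Type u := PresentedGroup (steinbergRels A)

theorem elemMat_steinbergRels (z : FreeGroup (Fin 2 × A)) (hz : z ∈ steinbergRels A) :
    FreeGroup.lift (fun p : Fin 2 × A => elemMat p.1 p.2) z = 1 := by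
  rcases hz with ⟨i, r, s, rfl⟩ | ⟨i, a, r, rfl⟩
  · rw [map_mul, map_inv, mul_inv_eq_one]
    ext k l
    fin_cases i <;> fin_cases k <;> fin_cases l <;>
      simp [freeX, elemMat, Matrix.mul_apply, Fin.sum_univ_two, add_comm]
  · rw [map_mul, map_inv, mul_inv_eq_one, map_mul, map_inv, mul_inv_eq_iff_eq_mul]
    ext k l
    fin_cases i <;> fin_cases k <;> fin_cases l <;>
      simp [freeX, freeW, elemMat, Matrix.mul_apply, Fin.sum_univ_two] <;>
      linear_combination (-(a : A) * r) * (Units.mul_inv a)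

/-- The natural map `φ : St(2, A) → GL₂(A)`, `x_{ij}(r) ↦ E_{ij}(r)`; its image is `E₂(A)`. -/
def steinbergMap : St2 A →* Matrix.GeneralLinearGroup (Fin 2) A :=
  PresentedGroup.toGroup (f := fun p : Fin 2 × A => elemMat p.1 p.2) (elemMat_steinbergRels A)

/-- `K₂(2, A)`, the kernel of `St(2, A) → E₂(A)`. -/
def K22 : Subgroup (St2 A) := (steinbergMap A).ker

variable {A}

/-- The generators `x_{ij}(r)` of the Steinberg group. -/
def stX (i : Fin 2) (r : A) : St2 A := PresentedGroup.of (i, r)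

/-- `w_{ij}(a) = x_{ij}(a) x_{ji}(-a⁻¹) x_{ij}(a)`. -/
def stW (i : Fin 2) (a : Aˣ) : St2 A :=
  stX i (a : A) * stX (i + 1) (-((a⁻¹ : Aˣ) : A)) * stX i (a : A)

/-- `h_{ij}(a) = w_{ij}(a) w_{ij}(-1)`. -/
def stH (i : Fin 2) (a : Aˣ) : St2 A := stW i a * stW i (-1)

/-- The Steinberg symbol `{a, b} = h₁₂(ab) h₁₂(a)⁻¹ h₁₂(b)⁻¹`. -/
def steinbergSymbol (a b : Aˣ) : St2 A := stH 0 (a * b) * (stH 0 a)⁻¹ * (stH 0 b)⁻¹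

/-- The Dennis–Stein symbol
`⟨a, b⟩_{ij} = x_{ji}(-b/c) x_{ij}(-a) x_{ji}(b) x_{ij}(a/c) h_{ij}(c)⁻¹` where the unit
`c` is `1 - ab`. -/
def dennisSteinSymbol (i : Fin 2) (a b : A) (c : Aˣ) (_hc : (c : A) = 1 - a * b) : St2 A :=
  stX (i + 1) (-b * ((c⁻¹ : Aˣ) : A)) * stX i (-a) * stX (i + 1) b *
    stX i (a * ((c⁻¹ : Aˣ) : A)) * (stH i c)⁻¹

variable (A)

/-- `C(2, A)`, the subgroup generated by the Steinberg symbols. -/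
def C2 : Subgroup (St2 A) := Subgroup.closure {z | ∃ a b : Aˣ, z = steinbergSymbol a b}

/-- `K₂(2, A)` is generated by Dennis–Stein symbols. -/
def K22GeneratedByDennisStein : Prop :=
  K22 A = Subgroup.closure
    {z | ∃ (i : Fin 2) (a b : A) (c : Aˣ) (hc : (c : A) = 1 - a * b),
      z = dennisSteinSymbol i a b c hc}

/-- `A` is universal for `GE₂` if `K₂(2, A)` is generated by Steinberg symbols. -/
def IsUniversalForGE2 : Prop := K22 A = C2 A

/-- A universal `GE₂`-ring is a `GE₂`-ring that is universal for `GE₂`. -/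
def IsUniversalGE2Ring : Prop := IsGE2Ring A ∧ IsUniversalForGE2 A

end Steinberg

/-!
The first homology of a group is its abelianization (`integralH1Equiv`), so everything is about
characters of `GE₂(A)`, that is, homomorphisms to commutative groups.

Upper bound. A character of `GE₂(A)` takes equal values at elements intertwined by a third one.
Diagonal matrices intertwine `E₁₂(r)` with `E₁₂(ur)` for every unit `u`, so on `E₁₂(A)` a character
factors through `A_{Aˣ}` (`map_geX_eq_one`). The matrix `E₁₂(1) E₂₁(-1) E₁₂(1)` intertwines `E₂₁(r)`
with `E₁₂(-r)` and `diag(u, v)` with `diag(v, u)`. Hence every value is attained at some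
`E₁₂(x) diag(u, 1)` (`exists_map_eq`), and if scalars go to `1`, then so does `diag(u², 1)`, which
has the same value as `diag(u, u)`. The abelianization of `PGE₂(A)` is thus a quotient of
`𝒢_A × A_{Aˣ}`.

Lower bound. The determinant detects `𝒢_A`. The factor `A_{Aˣ}` is detected as soon as there is a
character `l : GE₂(A) → A_{Aˣ}` that is the projection on `E₁₂(A)` and trivial on diagonal matrices
(`nonempty_integralH1_equiv_of_hom`). Such an `l` is obtained in three ways.

* The rule `x_{ij}(r) ↦ r` respects the Steinberg relations modulo the elements `a - 1` (signs are
  irrelevant, as `-1` is a unit), and it kills Steinberg and Dennis–Stein symbols. If these generate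
  `K₂(2, A)`, it descends to `E₂(A)`. Being invariant under conjugation by diagonal matrices, it
  extends to `GE₂(A)` by `g ↦ diag(det g, 1)⁻¹ g ∈ E₂(A)` (`GE2Coinv`).
* Over a local ring whose residue field is not `𝔽₂`, some `u` and `u - 1` are both units, so
  `A_{Aˣ} = 0` and there is nothing to construct (`subsingleton_unitCoinvariants`).
* Over `ℤ`, reduction modulo two followed by the signature of `GL₂(𝔽₂) ≅ S₃` is such a character
  (`intSignature`).

Local rings and `ℤ` are `GE₂`-rings by elimination and by the Euclidean algorithm, so that
`PGE₂` is `PGL₂` there.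
-/

open Matrix


/-! ### First homology as the abelianization -/

section Homology

/-- The first integral homology of a group is its abelianization. -/
noncomputable def integralH1Equiv (G : Type u) [Group G] :
    IntegralH1 G ≃+ Additive (Abelianization G) :=
  (groupHomology.H1AddEquivOfIsTrivial
    (Rep.trivial (ULift.{u} ℤ) G (ULift.{u} ℤ))).trans <|
  (TensorProduct.congr (LinearEquiv.refl ℤ (Additive (Abelianization G)))
    (ULift.moduleEquiv : ULift.{u} ℤ ≃ₗ[ℤ] ℤ)).toAddEquiv.trans
    (TensorProduct.rid ℤ (Additive (Abelianization G))).toAddEquiv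

/-- A surjection `F` from `G` onto a commutative group computes the first homology of a quotient `P`
of `G` if it factors through `P` and its kernel dies in the abelianization of `P`. -/
theorem nonempty_integralH1_equiv {G : Type*} {P : Type u} [Group G] [Group P] {H K : Type*}
    [CommGroup H] [AddCommGroup K] {p : G →* P} (hp : Function.Surjective p)
    {F : G →* H × Multiplicative K} (hF : Function.Surjective F) (hpF : p.ker ≤ F.ker)
    (hker : ∀ g, F g = 1 → Abelianization.of (p g) = 1) :
    Nonempty (IntegralH1 P ≃+ Additive H × K) := by
  have hf (g : G) : p.liftOfSurjective hp ⟨F, hpF⟩ (p g) = F g :=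
    p.liftOfRightInverse_comp_apply _ _ ⟨F, hpF⟩ g
  generalize p.liftOfSurjective hp ⟨F, hpF⟩ = f at hf
  have hbij : Function.Bijective (Abelianization.lift f) := by
    refine ⟨(injective_iff_map_eq_one _).2 fun x h => ?_, fun y => ?_⟩
    · induction x using QuotientGroup.induction_on with
      | H x =>
        obtain ⟨g, rfl⟩ := hp x
        exact hker g ((hf g).symm.trans h)
    · obtain ⟨g, rfl⟩ := hF y
      exact ⟨Abelianization.of (p g), hf g⟩
  exact ⟨(integralH1Equiv P).trans <|
    (MulEquiv.toAdditive (MulEquiv.ofBijective _ hbij)).trans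
      { toFun := fun x => (Additive.ofMul x.toMul.1, x.toMul.2.toAdd)
        invFun := fun x => Additive.ofMul (x.1.toMul, Multiplicative.ofAdd x.2)
        left_inv := fun _ => rfl
        right_inv := fun _ => rfl
        map_add' := fun _ _ => rfl }⟩

end Homology

/-! ### Diagonal and elementary matrices -/

section Matrices

variable {A : Type u} [CommRing A]

/-- The diagonal matrix `diag(u, v)`, as a homomorphism `Aˣ × Aˣ → GL₂(A)`. -/
def diagHom : Aˣ × Aˣ →* GL (Fin 2) A where
  toFun p := ⟨!![(p.1 : A), 0; 0, p.2], !![((p.1⁻¹ : Aˣ) : A), 0; 0, ((p.2⁻¹ : Aˣ) : A)],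
    by simp [Matrix.one_fin_two], by simp [Matrix.one_fin_two]⟩
  map_one' := by ext i j; fin_cases i <;> fin_cases j <;> simp
  map_mul' p q := by
    ext i j; fin_cases i <;> fin_cases j <;> simp [Matrix.mul_apply, Fin.sum_univ_two]

theorem coe_diagHom (p : Aˣ × Aˣ) :
    (diagHom p : Matrix (Fin 2) (Fin 2) A) = !![(p.1 : A), 0; 0, p.2] := rfl

theorem coe_elemMat_zero (r : A) :
    (elemMat 0 r : Matrix (Fin 2) (Fin 2) A) = !![1, r; 0, 1] := rfl

theorem coe_elemMat_one (r : A) :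
    (elemMat 1 r : Matrix (Fin 2) (Fin 2) A) = !![1, 0; r, 1] := rfl

theorem diagHom_one_one : diagHom ((1, 1) : Aˣ × Aˣ) = 1 := map_one diagHom

theorem det_diagHom (p : Aˣ × Aˣ) : GeneralLinearGroup.det (diagHom p) = p.1 * p.2 := by
  ext
  simp [coe_diagHom, Matrix.det_fin_two]

theorem det_elemMat (i : Fin 2) (r : A) : GeneralLinearGroup.det (elemMat i r) = 1 := by
  ext
  fin_cases i <;> simp [coe_elemMat_zero, coe_elemMat_one, Matrix.det_fin_two]

theorem elemMat_add (i : Fin 2) (r s : A) :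
    elemMat i (r + s) = elemMat i r * elemMat i s := by
  ext k l
  fin_cases i <;> fin_cases k <;> fin_cases l <;>
    simp [coe_elemMat_zero, coe_elemMat_one, Matrix.mul_apply, Fin.sum_univ_two, add_comm]

theorem diagHom_mul_elemMat_zero (u v : Aˣ) (r : A) :
    diagHom (u, v) * elemMat 0 r = elemMat 0 ((u * v⁻¹ : Aˣ) * r) * diagHom (u, v) := by
  ext k l
  fin_cases k <;> fin_cases l <;>
    simp [coe_elemMat_zero, coe_diagHom, Matrix.mul_apply, Fin.sum_univ_two]
  linear_combination (-(u : A) * r) * (Units.mul_inv v)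

theorem diagHom_mul_elemMat_one (u v : Aˣ) (r : A) :
    diagHom (u, v) * elemMat 1 r = elemMat 1 ((v * u⁻¹ : Aˣ) * r) * diagHom (u, v) := by
  ext k l
  fin_cases k <;> fin_cases l <;>
    simp [coe_elemMat_one, coe_diagHom, Matrix.mul_apply, Fin.sum_univ_two]
  linear_combination (-(v : A) * r) * (Units.mul_inv u)

/-- Conjugation by a diagonal matrix scales the parameter of an elementary matrix by a unit. -/
theorem exists_conj_elemMat (p : Aˣ × Aˣ) (i : Fin 2) :
    ∃ c : Aˣ, ∀ r : A, (diagHom p)⁻¹ * elemMat i r * diagHom p = elemMat i (c * r) := by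
  obtain ⟨u, v⟩ := p
  rw [← map_inv]
  fin_cases i
  · refine ⟨u⁻¹ * v⁻¹⁻¹, fun r => ?_⟩
    change diagHom (u⁻¹, v⁻¹) * elemMat 0 r * _ = _
    rw [diagHom_mul_elemMat_zero, mul_assoc, ← map_mul]
    simp [diagHom_one_one]
  · refine ⟨v⁻¹ * u⁻¹⁻¹, fun r => ?_⟩
    change diagHom (u⁻¹, v⁻¹) * elemMat 1 r * _ = _
    rw [diagHom_mul_elemMat_one, mul_assoc, ← map_mul]
    simp [diagHom_one_one]

theorem diagHom_mem_D2 (p : Aˣ × Aˣ) : diagHom p ∈ D2 A := by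
  refine Subgroup.subset_closure fun i j hij => ?_
  fin_cases i <;> fin_cases j <;> simp_all [coe_diagHom]

theorem D2_eq_range : D2 A = (diagHom (A := A)).range := by
  refine le_antisymm ((Subgroup.closure_le _).2 fun g hg => ?_) ?_
  · have h01 : (g : Matrix (Fin 2) (Fin 2) A) 0 1 = 0 := hg (by decide)
    have h10 : (g : Matrix (Fin 2) (Fin 2) A) 1 0 = 0 := hg (by decide)
    have hu : IsUnit ((g : Matrix (Fin 2) (Fin 2) A) 0 0 * (g : Matrix (Fin 2) (Fin 2) A) 1 1) := by
      have h := (GeneralLinearGroup.det g).isUnit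
      rwa [GeneralLinearGroup.val_det_apply, Matrix.det_fin_two, h01, zero_mul, sub_zero] at h
    obtain ⟨hu, hv⟩ := IsUnit.mul_iff.1 hu
    refine ⟨(hu.unit, hv.unit), ?_⟩
    ext i j
    fin_cases i <;> fin_cases j <;> simp [coe_diagHom, h01, h10]
  · rintro _ ⟨p, rfl⟩
    exact diagHom_mem_D2 p

theorem diagHom_mem_GE2 (p : Aˣ × Aˣ) : diagHom p ∈ GE2 A :=
  Subgroup.mem_sup_left (diagHom_mem_D2 p)

theorem elemMat_mem_GE2 (i : Fin 2) (r : A) : elemMat i r ∈ GE2 A :=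
  Subgroup.mem_sup_right (Subgroup.subset_closure ⟨i, r, rfl⟩)

/-- `GE₂(A)` is generated by the matrices `diag(u, v)` and the elementary matrices. -/
theorem GE2_eq_closure :
    GE2 A = Subgroup.closure (Set.range diagHom ∪ {g | ∃ (i : Fin 2) (r : A), g = elemMat i r}) := by
  rw [Subgroup.closure_union, GE2, E2, D2_eq_range, ← MonoidHom.coe_range, Subgroup.closure_eq]

theorem mem_center_iff_diagHom {g : GL (Fin 2) A} :
    g ∈ Subgroup.center (GL (Fin 2) A) ↔ ∃ u : Aˣ, diagHom (u, u) = g := by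
  rw [GeneralLinearGroup.center_eq_range_scalar]
  refine exists_congr fun u => ?_
  have : GeneralLinearGroup.scalar (Fin 2) u = diagHom (u, u) := by
    ext i j
    fin_cases i <;> fin_cases j <;> simp [coe_diagHom, GeneralLinearGroup.coe_scalar]
  rw [this]

end Matrices

/-! ### The coinvariants of the units -/

section Coinvariants

variable {A : Type u} [CommRing A]

/-- The projection `A → A_{Aˣ}`, written multiplicatively in the target. -/
def coinv (r : A) : Multiplicative (UnitCoinvariants A) :=
  Multiplicative.ofAdd (Ideal.Quotient.mk _ r)

theorem coinv_add (r s : A) : coinv (r + s) = coinv r * coinv s := rfl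

theorem coinv_neg (r : A) : coinv (-r) = (coinv r)⁻¹ := rfl

theorem coinv_eq_one_iff {r : A} :
    coinv r = 1 ↔ r ∈ Ideal.span {x : A | ∃ a : Aˣ, x = (a : A) - 1} :=
  Ideal.Quotient.eq_zero_iff_mem

theorem coinv_unit_mul (u : Aˣ) (r : A) : coinv (u * r) = coinv r := by
  refine congrArg Multiplicative.ofAdd (Ideal.Quotient.eq.2 ?_)
  have : (u : A) * r - r = r * (u - 1) := by ring
  rw [this]
  exact Ideal.mul_mem_left _ _ (Ideal.subset_span ⟨u, rfl⟩)

/-- `-1` is a unit, so the coinvariants have exponent two. -/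
theorem inv_coinv (r : A) : (coinv r)⁻¹ = coinv r := by
  rw [← coinv_neg, ← coinv_unit_mul (-1) r]
  simp

theorem coinv_mul_self (r : A) : coinv r * coinv r = 1 := by
  nth_rw 1 [← inv_coinv, inv_mul_cancel]

theorem coinv_unit (u : Aˣ) : coinv (u : A) = coinv 1 := by
  simpa using coinv_unit_mul u 1

end Coinvariants

/-! ### The abelianization of `GE₂` modulo scalars -/

section Abelianization

variable {A : Type u} [CommRing A]

/-- An elementary matrix as an element of `GE₂(A)`. -/
def geX (i : Fin 2) (r : A) : GE2 A := ⟨elemMat i r, elemMat_mem_GE2 i r⟩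

/-- The diagonal matrices as a homomorphism to `GE₂(A)`. -/
def geD : Aˣ × Aˣ →* GE2 A := diagHom.codRestrict _ diagHom_mem_GE2

theorem geX_add (i : Fin 2) (r s : A) : geX i (r + s) = geX i r * geX i s :=
  Subtype.ext (elemMat_add i r s)

theorem geX_zero (i : Fin 2) : geX i (0 : A) = 1 := by
  simpa using geX_add i (0 : A) 0

theorem closure_geD_geX :
    Subgroup.closure (Set.range geD ∪ Set.range fun q : Fin 2 × A => geX q.1 q.2) = ⊤ := by
  have himg : (GE2 A).subtype '' (Set.range geD ∪ Set.range fun q : Fin 2 × A => geX q.1 q.2) =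
      Set.range diagHom ∪ {g | ∃ (i : Fin 2) (r : A), g = elemMat i r} := by
    rw [Set.image_union, ← Set.range_comp, ← Set.range_comp]
    congr 1
    ext g
    exact ⟨fun ⟨q, h⟩ => ⟨q.1, q.2, h.symm⟩, fun ⟨i, r, h⟩ => ⟨(i, r), h.symm⟩⟩
  refine Subgroup.map_injective (GE2 A).subtype_injective ?_
  rw [MonoidHom.map_closure, himg, ← GE2_eq_closure, ← MonoidHom.range_eq_map,
    Subgroup.range_subtype]

/-- The matrix `E₁₂(1) E₂₁(-1) E₁₂(1)`, which exchanges the coordinates up to sign. -/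
def geW : GE2 A := geX 0 1 * geX 1 (-1) * geX 0 1

theorem coe_geW :
    (((geW : GE2 A) : GL (Fin 2) A) : Matrix (Fin 2) (Fin 2) A) = !![0, 1; -1, 0] := by
  change ((elemMat 0 (1 : A) : GL (Fin 2) A) : Matrix (Fin 2) (Fin 2) A) *
    (elemMat 1 (-1 : A) : GL (Fin 2) A) * (elemMat 0 (1 : A) : GL (Fin 2) A) = _
  simp [coe_elemMat_zero, coe_elemMat_one]

theorem geW_mul_geX (r : A) : geW * geX 1 r = geX 0 (-r) * geW := by
  refine Subtype.ext (Units.ext ?_)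
  rw [Subgroup.coe_mul, Subgroup.coe_mul, Units.val_mul, Units.val_mul, coe_geW]
  change _ * (elemMat 1 r : Matrix (Fin 2) (Fin 2) A) = elemMat 0 (-r) * _
  simp [coe_elemMat_zero, coe_elemMat_one]

theorem geW_mul_geD (u v : Aˣ) : geW * geD (u, v) = geD (v, u) * geW := by
  refine Subtype.ext (Units.ext ?_)
  rw [Subgroup.coe_mul, Subgroup.coe_mul, Units.val_mul, Units.val_mul, coe_geW]
  change _ * (diagHom (u, v) : Matrix (Fin 2) (Fin 2) A) = diagHom (v, u) * _
  simp [coe_diagHom]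

section Characters

variable {C : Type*} [CommGroup C] (c : GE2 A →* C)

theorem map_eq_of_intertwine {w g g' : GE2 A} (h : w * g = g' * w) : c g = c g' := by
  have h' := congrArg c h
  rw [map_mul, map_mul, mul_comm] at h'
  exact mul_right_cancel h'

theorem map_geX_unit_mul (u : Aˣ) (r : A) : c (geX 0 (u * r)) = c (geX 0 r) := by
  refine (map_eq_of_intertwine c (w := geD (u, 1)) (Subtype.ext ?_)).symm
  change diagHom (u, 1) * elemMat 0 r = elemMat 0 (u * r) * diagHom (u, 1)
  simpa using diagHom_mul_elemMat_zero u 1 r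

theorem map_geX_one (r : A) : c (geX 1 r) = c (geX 0 (-r)) :=
  map_eq_of_intertwine c (geW_mul_geX r)

theorem map_geD (u v : Aˣ) : c (geD (u, v)) = c (geD (u * v, 1)) := by
  have h : ∀ u v : Aˣ, ((u, v) : Aˣ × Aˣ) = (u, 1) * (1, v) := fun u v => by simp
  have h' : ((u * v, 1) : Aˣ × Aˣ) = (u, 1) * (v, 1) := by simp
  rw [h, h', map_mul, map_mul, map_mul, map_mul, map_eq_of_intertwine c (geW_mul_geD 1 v)]

/-- A character of `GE₂(A)` factors through `A_{Aˣ}` on `E₁₂(A)`. -/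
theorem map_geX_eq_one {x : A} (hx : coinv x = 1) : c (geX 0 x) = 1 := by
  rw [coinv_eq_one_iff] at hx
  suffices h : ∀ r : A, c (geX 0 (r * x)) = 1 by simpa using h 1
  induction hx using Submodule.span_induction with
  | mem y hy =>
    obtain ⟨a, rfl⟩ := hy
    intro r
    have h := geX_add 0 (r * ((a : A) - 1)) r
    rw [show r * ((a : A) - 1) + r = a * r by ring] at h
    have h' := congrArg c h
    rwa [map_geX_unit_mul, map_mul, right_eq_mul] at h'
  | zero => intro r; rw [mul_zero, geX_zero, map_one]
  | add y z _ _ hy hz => intro r; rw [mul_add, geX_add, map_mul, hy, hz, one_mul]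
  | smul a y _ hy => intro r; rw [smul_eq_mul, ← mul_assoc, hy]

/-- Every value of a character of `GE₂(A)` is a value at some `E₁₂(x) diag(u, 1)`. -/
theorem exists_map_eq (g : GE2 A) : ∃ (x : A) (u : Aˣ), c g = c (geX 0 x * geD (u, 1)) := by
  have hg : g ∈ Subgroup.closure (Set.range geD ∪ Set.range fun q : Fin 2 × A => geX q.1 q.2) := by
    rw [closure_geD_geX]
    trivial
  have hinvX (x : A) : (geX 0 x)⁻¹ = geX 0 (-x) := by
    rw [inv_eq_iff_mul_eq_one, ← geX_add, add_neg_cancel, geX_zero]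
  have hD (u v : Aˣ) : (geD (u * v, 1) : GE2 A) = geD (u, 1) * geD (v, 1) := by
    rw [← map_mul, Prod.mk_mul_mk, one_mul]
  have hinvD (u : Aˣ) : (geD (u, 1) : GE2 A)⁻¹ = geD (u⁻¹, 1) := by
    rw [← map_inv, Prod.inv_mk, inv_one]
  induction hg using Subgroup.closure_induction with
  | mem g hg =>
    rcases hg with ⟨⟨u, v⟩, rfl⟩ | ⟨⟨i, r⟩, rfl⟩
    · exact ⟨0, u * v, by rw [geX_zero, one_mul, map_geD]⟩
    · fin_cases i
      · exact ⟨r, 1, by rw [← Prod.one_eq_mk, map_one, mul_one]; rfl⟩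
      · exact ⟨-r, 1, by rw [← Prod.one_eq_mk, map_one, mul_one]; exact map_geX_one c r⟩
  | one => exact ⟨0, 1, by rw [← Prod.one_eq_mk, map_one geD, mul_one, geX_zero]⟩
  | mul g h _ _ ihg ihh =>
    obtain ⟨x, u, hg⟩ := ihg
    obtain ⟨y, v, hh⟩ := ihh
    refine ⟨x + y, u * v, ?_⟩
    rw [map_mul, hg, hh, geX_add, hD]
    simp only [map_mul]
    exact mul_mul_mul_comm _ _ _ _
  | inv g _ ihg =>
    obtain ⟨x, u, hg⟩ := ihg
    refine ⟨-x, u⁻¹, ?_⟩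
    rw [map_inv, hg, ← hinvX, ← hinvD]
    simp only [map_mul, map_inv, mul_inv]

theorem exists_map_eq_and_map_eq {C' : Type*} [CommGroup C'] (c' : GE2 A →* C') (g : GE2 A) :
    ∃ (x : A) (u : Aˣ), c g = c (geX 0 x * geD (u, 1)) ∧ c' g = c' (geX 0 x * geD (u, 1)) := by
  obtain ⟨x, u, h⟩ := exists_map_eq (c.prod c') g
  exact ⟨x, u, Prod.ext_iff.1 h⟩

end Characters

/-- The pair formed by the square class of the determinant and a character with values in
`A_{Aˣ}`. -/
def detProd (l : GE2 A →* Multiplicative (UnitCoinvariants A)) :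
    GE2 A →* SquareClassGroup A × Multiplicative (UnitCoinvariants A) :=
  ((QuotientGroup.mk' _).comp (GeneralLinearGroup.det.comp (GE2 A).subtype)).prod l

variable {l : GE2 A →* Multiplicative (UnitCoinvariants A)}

theorem detProd_geX_mul_geD (hlX : ∀ r, l (geX 0 r) = coinv r) (hlD : ∀ q, l (geD q) = 1)
    (x : A) (u : Aˣ) : detProd l (geX 0 x * geD (u, 1)) = (QuotientGroup.mk u, coinv x) := by
  refine Prod.ext (congrArg QuotientGroup.mk ?_) ?_
  · change GeneralLinearGroup.det (elemMat 0 x * diagHom (u, 1)) = u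
    rw [map_mul, det_elemMat, det_diagHom, one_mul, mul_one]
  · change l _ = _
    rw [map_mul, hlX, hlD, mul_one]

theorem detProd_scalar (hlD : ∀ q, l (geD q) = 1) (u : Aˣ) : detProd l (geD (u, u)) = 1 := by
  refine Prod.ext ((QuotientGroup.eq_one_iff _).2 ⟨u, ?_⟩) (hlD _)
  exact (pow_two u).trans (det_diagHom (u, u)).symm

theorem detProd_surjective (hlX : ∀ r, l (geX 0 r) = coinv r) (hlD : ∀ q, l (geD q) = 1) :
    Function.Surjective (detProd l) := by
  rintro ⟨s, m⟩
  obtain ⟨u, rfl⟩ := QuotientGroup.mk_surjective s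
  obtain ⟨x, rfl⟩ := Ideal.Quotient.mk_surjective m
  exact ⟨_, detProd_geX_mul_geD hlX hlD x u⟩

/-- `diag(v², 1)` has the class of the scalar matrix `diag(v, v)`, so a character that is trivial on
scalars vanishes where `detProd` does. -/
theorem map_eq_one_of_detProd_eq_one (hlX : ∀ r, l (geX 0 r) = coinv r)
    (hlD : ∀ q, l (geD q) = 1) {C : Type*} [CommGroup C] (c : GE2 A →* C)
    (hc : ∀ u : Aˣ, c (geD (u, u)) = 1) {g : GE2 A} (hg : detProd l g = 1) : c g = 1 := by
  obtain ⟨x, u, hxu, hxu'⟩ := exists_map_eq_and_map_eq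
    (C' := SquareClassGroup A × Multiplicative (UnitCoinvariants A)) c (detProd l) g
  rw [hg, detProd_geX_mul_geD hlX hlD, eq_comm, Prod.mk_eq_one, QuotientGroup.eq_one_iff] at hxu'
  obtain ⟨⟨v, rfl⟩, hx⟩ := hxu'
  rw [hxu, map_mul, map_geX_eq_one _ hx, one_mul]
  have h := map_geD c v v
  rw [hc, ← pow_two] at h
  exact h.symm

/-- If a homomorphism `l : GE₂(A) → A_{Aˣ}` restricts to the projection on `E₁₂(A) ≅ A` and is
trivial on diagonal matrices, then together with the determinant it computes the first homology of
`PGE₂(A)`, given here as an arbitrary quotient `P` of `GE₂(A)` by the scalar matrices. -/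
theorem nonempty_integralH1_equiv_of_hom {P : Type u} [Group P] (p : GE2 A →* P)
    (hp : Function.Surjective p)
    (hker : p.ker = (Subgroup.center (GL (Fin 2) A)).subgroupOf (GE2 A))
    (hlX : ∀ r, l (geX 0 r) = coinv r) (hlD : ∀ q, l (geD q) = 1) :
    Nonempty (IntegralH1 P ≃+ Additive (SquareClassGroup A) × UnitCoinvariants A) := by
  refine nonempty_integralH1_equiv (H := SquareClassGroup A) (K := UnitCoinvariants A) hp
    (detProd_surjective hlX hlD) ?_ fun g hg => ?_
  · rintro ⟨g, hg⟩ h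
    rw [hker, Subgroup.mem_subgroupOf] at h
    obtain ⟨u, rfl⟩ := mem_center_iff_diagHom.1 h
    exact detProd_scalar hlD u
  · refine map_eq_one_of_detProd_eq_one hlX hlD (Abelianization.of.comp p) (fun u => ?_) hg
    have : p (geD (u, u)) = 1 := by
      rw [← MonoidHom.mem_ker, hker, Subgroup.mem_subgroupOf]
      exact mem_center_iff_diagHom.2 ⟨u, rfl⟩
    rw [MonoidHom.comp_apply, this, map_one]

end Abelianization

/-! ### The character coming from the Steinberg group -/

section Steinberg

variable {A : Type u} [CommRing A]

/-- The homomorphism `St(2, A) → A_{Aˣ}` sending both `x₁₂(r)` and `x₂₁(r)` to the class of `r`.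
Signs do not matter, because `-1` is a unit. -/
def steinbergCoinv : St2 A →* Multiplicative (UnitCoinvariants A) :=
  PresentedGroup.toGroup (f := fun q : Fin 2 × A => coinv q.2) (rels := steinbergRels A) <| by
    rintro z (⟨i, r, s, rfl⟩ | ⟨i, a, r, rfl⟩)
    · simp [freeX, coinv_add]
    · have h : coinv (-((a : A) ^ 2 * r)) = coinv r := by
        rw [coinv_neg, inv_coinv, ← Units.val_pow_eq_pow_val, coinv_unit_mul]
      rw [map_mul, map_mul, map_mul, map_inv, map_inv, mul_inv_cancel_comm,
        mul_inv_eq_one]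
      simp [freeX, h]

theorem steinbergCoinv_stX (i : Fin 2) (r : A) : steinbergCoinv (stX i r) = coinv r :=
  PresentedGroup.toGroup.of _

theorem steinbergCoinv_stW (i : Fin 2) (u : Aˣ) : steinbergCoinv (stW i u) = coinv 1 := by
  rw [stW, map_mul, map_mul, steinbergCoinv_stX, steinbergCoinv_stX, coinv_neg,
    inv_coinv, coinv_unit, coinv_unit, coinv_mul_self, one_mul]

theorem steinbergCoinv_stH (i : Fin 2) (u : Aˣ) : steinbergCoinv (stH i u) = 1 := by
  rw [stH, map_mul, steinbergCoinv_stW, steinbergCoinv_stW, coinv_mul_self]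

theorem steinbergCoinv_steinbergSymbol (u v : Aˣ) : steinbergCoinv (steinbergSymbol u v) = 1 := by
  simp only [steinbergSymbol, map_mul, map_inv, steinbergCoinv_stH, inv_one, mul_one]

theorem steinbergCoinv_dennisSteinSymbol (i : Fin 2) (a b : A) (c : Aˣ) (hc : (c : A) = 1 - a * b) :
    steinbergCoinv (dennisSteinSymbol i a b c hc) = 1 := by
  simp only [dennisSteinSymbol, map_mul, map_inv, steinbergCoinv_stH, steinbergCoinv_stX, inv_one,
    mul_one]
  rw [mul_comm (-b), mul_comm a, coinv_unit_mul, coinv_unit_mul, coinv_neg, coinv_neg,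
    mul_assoc, mul_assoc, mul_comm (coinv b), inv_mul_cancel_left, inv_mul_cancel]

theorem K22_le_ker_of_dennisStein (h : K22GeneratedByDennisStein A) :
    K22 A ≤ (steinbergCoinv (A := A)).ker := by
  rw [h, Subgroup.closure_le]
  rintro _ ⟨i, a, b, c, hc, rfl⟩
  exact steinbergCoinv_dennisSteinSymbol i a b c hc

theorem K22_le_ker_of_universal (h : IsUniversalForGE2 A) :
    K22 A ≤ (steinbergCoinv (A := A)).ker := by
  rw [h, C2, Subgroup.closure_le]
  rintro _ ⟨a, b, rfl⟩
  exact steinbergCoinv_steinbergSymbol a b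

theorem steinbergMap_stX (i : Fin 2) (r : A) : steinbergMap A (stX i r) = elemMat i r :=
  PresentedGroup.toGroup.of _

theorem steinbergMap_stH (u : Aˣ) : steinbergMap A (stH 0 u) = diagHom (u, u⁻¹) := by
  have h : (0 : Fin 2) + 1 = 1 := rfl
  simp only [stH, stW, map_mul, steinbergMap_stX, h]
  refine Units.ext ?_
  simp only [Units.val_mul, coe_elemMat_zero, coe_elemMat_one, coe_diagHom]
  ext i j
  fin_cases i <;> fin_cases j <;> simp [Matrix.mul_apply, Fin.sum_univ_two]

theorem range_steinbergMap : (steinbergMap A).range = E2 A := by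
  rw [MonoidHom.range_eq_map, ← PresentedGroup.closure_range_of, MonoidHom.map_closure, E2,
    ← Set.range_comp]
  congr 1
  ext g
  exact ⟨fun ⟨q, h⟩ => ⟨q.1, q.2, h.symm.trans (steinbergMap_stX q.1 q.2)⟩,
    fun ⟨i, r, h⟩ => ⟨(i, r), (steinbergMap_stX i r).trans h.symm⟩⟩

theorem conj_diagHom_mem_E2 (q : Aˣ × Aˣ) {x : GL (Fin 2) A} (hx : x ∈ E2 A) :
    (diagHom q)⁻¹ * x * diagHom q ∈ E2 A := by
  have h : E2 A ≤ (E2 A).comap (MulAut.conj (diagHom q)⁻¹).toMonoidHom := by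
    refine (Subgroup.closure_le _).2 ?_
    rintro _ ⟨i, r, rfl⟩
    obtain ⟨c, hc⟩ := exists_conj_elemMat q i
    exact Subgroup.subset_closure ⟨i, c * r, by simpa using hc r⟩
  simpa using h hx

/-- The section `g ↦ diag(det g, 1)` of the determinant, as an endomorphism of `GL₂(A)`. -/
def detDiag : GL (Fin 2) A →* GL (Fin 2) A := diagHom.comp (GeneralLinearGroup.det.prod 1)

theorem detDiag_apply (g : GL (Fin 2) A) : detDiag g = diagHom (GeneralLinearGroup.det g, 1) := rfl

theorem inv_detDiag_diagHom_mul (u v : Aˣ) :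
    (detDiag (diagHom (u, v)))⁻¹ * diagHom (u, v) = steinbergMap A (stH 0 v⁻¹) := by
  rw [steinbergMap_stH, detDiag_apply, det_diagHom, ← map_inv, ← map_mul]
  congr 1
  simp

theorem inv_detDiag_elemMat_mul (i : Fin 2) (r : A) :
    (detDiag (elemMat i r))⁻¹ * elemMat i r = elemMat i r := by
  rw [detDiag_apply, det_elemMat, diagHom_one_one, inv_one, one_mul]

/-- The elements of determinant one in `GE₂(A)` lie in `E₂(A)`; the factor `diag(det g, 1)⁻¹`
brings an arbitrary `g` to determinant one. -/
theorem inv_detDiag_mul_mem_E2 {g : GL (Fin 2) A} (hg : g ∈ GE2 A) :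
    (detDiag g)⁻¹ * g ∈ E2 A := by
  rw [GE2_eq_closure] at hg
  induction hg using Subgroup.closure_induction with
  | mem x hx =>
    rcases hx with ⟨⟨u, v⟩, rfl⟩ | ⟨i, r, rfl⟩
    · rw [← range_steinbergMap]
      exact ⟨_, (inv_detDiag_diagHom_mul u v).symm⟩
    · rw [inv_detDiag_elemMat_mul]
      exact Subgroup.subset_closure ⟨i, r, rfl⟩
  | one =>
    rw [map_one, inv_one, one_mul]
    exact one_mem _
  | mul x y _ _ hx hy =>
    have : (detDiag y)⁻¹ * ((detDiag x)⁻¹ * x) * detDiag y * ((detDiag y)⁻¹ * y) ∈ E2 A :=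
      mul_mem (conj_diagHom_mem_E2 _ hx) hy
    rw [map_mul]
    simpa [mul_assoc] using this
  | inv x _ hx =>
    have : ((detDiag x⁻¹)⁻¹ * ((detDiag x)⁻¹ * x) * detDiag x⁻¹)⁻¹ ∈ E2 A :=
      inv_mem (conj_diagHom_mem_E2 _ hx)
    rw [map_inv] at this ⊢
    simpa [mul_assoc] using this

variable (hK : K22 A ≤ (steinbergCoinv (A := A)).ker)

/-- If `St(2, A) → A_{Aˣ}` kills `K₂(2, A)`, it descends to `E₂(A)`. -/
noncomputable def E2Coinv : E2 A →* Multiplicative (UnitCoinvariants A) :=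
  ((steinbergMap A).rangeRestrict.liftOfSurjective (G₃ := Multiplicative (UnitCoinvariants A))
    (steinbergMap A).rangeRestrict_surjective
    ⟨steinbergCoinv, by rwa [MonoidHom.ker_rangeRestrict]⟩).comp
    (MulEquiv.subgroupCongr range_steinbergMap.symm).toMonoidHom

theorem E2Coinv_steinbergMap (z : St2 A) (hz : steinbergMap A z ∈ E2 A) :
    E2Coinv hK ⟨steinbergMap A z, hz⟩ = steinbergCoinv z :=
  (steinbergMap A).rangeRestrict.liftOfRightInverse_comp_apply
    (G₃ := Multiplicative (UnitCoinvariants A)) _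
    (Function.rightInverse_surjInv (steinbergMap A).rangeRestrict_surjective)
    ⟨steinbergCoinv, by rwa [MonoidHom.ker_rangeRestrict]⟩ z

theorem E2Coinv_elemMat (i : Fin 2) (r : A) (h : elemMat i r ∈ E2 A) :
    E2Coinv hK ⟨elemMat i r, h⟩ = coinv r := by
  have := E2Coinv_steinbergMap hK (stX i r) (by rwa [steinbergMap_stX])
  rw [steinbergCoinv_stX] at this
  rw [← this]
  simp only [steinbergMap_stX]

theorem E2Coinv_conj (q : Aˣ × Aˣ) (x : E2 A) :
    E2Coinv hK ⟨_, conj_diagHom_mem_E2 q x.2⟩ = E2Coinv hK x := by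
  obtain ⟨x, hx⟩ := x
  have hx' := hx
  rw [E2] at hx'
  induction hx' using Subgroup.closure_induction with
  | mem x hx' =>
    obtain ⟨i, r, rfl⟩ := hx'
    obtain ⟨c, hc⟩ := exists_conj_elemMat q i
    simp only [hc, E2Coinv_elemMat, coinv_unit_mul]
  | one =>
    have h : (⟨_, conj_diagHom_mem_E2 q hx⟩ : E2 A) = 1 := Subtype.ext (by simp)
    have h' : (⟨1, hx⟩ : E2 A) = 1 := rfl
    rw [h, h']
  | mul x y hx' hy' ihx ihy =>
    have h : (⟨_, conj_diagHom_mem_E2 q hx⟩ : E2 A) =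
      ⟨_, conj_diagHom_mem_E2 q hx'⟩ * ⟨_, conj_diagHom_mem_E2 q hy'⟩ :=
        Subtype.ext (by simp [mul_assoc])
    have h' : (⟨x * y, hx⟩ : E2 A) = ⟨x, hx'⟩ * ⟨y, hy'⟩ := rfl
    rw [h, h', map_mul, map_mul]
    exact congrArg₂ _ (ihx hx') (ihy hy')
  | inv x hx' ihx =>
    have h : (⟨_, conj_diagHom_mem_E2 q hx⟩ : E2 A) = ⟨_, conj_diagHom_mem_E2 q hx'⟩⁻¹ :=
        Subtype.ext (by simp [mul_assoc])
    have h' : (⟨x⁻¹, hx⟩ : E2 A) = ⟨x, hx'⟩⁻¹ := rfl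
    rw [h, h', map_inv, map_inv]
    exact congrArg _ (ihx hx')

/-- The extension of `E2Coinv` to `GE₂(A)` that is trivial on the matrices `diag(u, 1)`. It is
multiplicative because `E2Coinv` is invariant under conjugation by diagonal matrices. -/
noncomputable def GE2Coinv : GE2 A →* Multiplicative (UnitCoinvariants A) :=
  MonoidHom.mk' (fun g => E2Coinv hK ⟨_, inv_detDiag_mul_mem_E2 g.2⟩) fun g h => by
    rw [← E2Coinv_conj hK (GeneralLinearGroup.det h.1, 1) ⟨_, inv_detDiag_mul_mem_E2 g.2⟩,
      ← map_mul]
    refine congrArg (E2Coinv hK) (Subtype.ext ?_)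
    change (detDiag (g.1 * h.1))⁻¹ * (g.1 * h.1) =
      (detDiag h.1)⁻¹ * ((detDiag g.1)⁻¹ * g.1) * detDiag h.1 * ((detDiag h.1)⁻¹ * h.1)
    rw [map_mul]
    simp [mul_assoc]

theorem GE2Coinv_eq {g : GE2 A} {z : St2 A} (h : (detDiag g.1)⁻¹ * g.1 = steinbergMap A z) :
    GE2Coinv hK g = steinbergCoinv z := by
  rw [← E2Coinv_steinbergMap hK z (h ▸ inv_detDiag_mul_mem_E2 g.2)]
  exact congrArg (E2Coinv hK) (Subtype.ext h)

theorem GE2Coinv_geX (r : A) : GE2Coinv hK (geX 0 r) = coinv r := by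
  rw [← steinbergCoinv_stX 0 r]
  refine GE2Coinv_eq hK ?_
  rw [steinbergMap_stX]
  exact inv_detDiag_elemMat_mul 0 r

theorem GE2Coinv_geD (q : Aˣ × Aˣ) : GE2Coinv hK (geD q) = 1 := by
  rw [← steinbergCoinv_stH 0 q.2⁻¹]
  exact GE2Coinv_eq hK (inv_detDiag_diagHom_mul q.1 q.2)

end Steinberg

/-! ### `GE₂`-rings and local rings -/

section GE2Rings

variable {A : Type u} [CommRing A]

/-- A character of `GE₂(A)` as in `nonempty_integralH1_equiv_of_hom` computes the first homology of
`PGE₂(A)`. -/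
theorem nonempty_integralH1_PGE2_equiv {l : GE2 A →* Multiplicative (UnitCoinvariants A)}
    (hlX : ∀ r, l (geX 0 r) = coinv r) (hlD : ∀ q, l (geD q) = 1) :
    Nonempty (IntegralH1 (PGE2 A) ≃+ Additive (SquareClassGroup A) × UnitCoinvariants A) :=
  nonempty_integralH1_equiv_of_hom (QuotientGroup.mk' _) (QuotientGroup.mk'_surjective _)
    (QuotientGroup.ker_mk' _) hlX hlD

theorem nonempty_integralH1_PGL2_equiv (hA : IsGE2Ring A)
    {l : GE2 A →* Multiplicative (UnitCoinvariants A)}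
    (hlX : ∀ r, l (geX 0 r) = coinv r) (hlD : ∀ q, l (geD q) = 1) :
    Nonempty (IntegralH1 (ProjGenLinGroup (Fin 2) A) ≃+
      Additive (SquareClassGroup A) × UnitCoinvariants A) := by
  refine nonempty_integralH1_equiv_of_hom (ProjGenLinGroup.mk.comp (GE2 A).subtype) ?_ ?_ hlX hlD
  · intro x
    induction x using ProjGenLinGroup.induction_on with
    | mk g => exact ⟨⟨g, hA ▸ Subgroup.mem_top g⟩, rfl⟩
  · rw [← MonoidHom.comap_ker, ProjGenLinGroup.ker_mk]
    rfl

theorem mem_GE2_of_isUnit {g : GL (Fin 2) A}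
    (h : IsUnit ((g : Matrix (Fin 2) (Fin 2) A) 0 0)) : g ∈ GE2 A := by
  obtain ⟨u, hu⟩ := h
  have hdet : ((GeneralLinearGroup.det g : Aˣ) : A) = u * g 1 1 - g 0 1 * g 1 0 := by
    rw [GeneralLinearGroup.val_det_apply, Matrix.det_fin_two, hu]
  have hg : g = elemMat 1 (g 1 0 * (u⁻¹ : Aˣ)) * diagHom (u, u⁻¹ * GeneralLinearGroup.det g) *
      elemMat 0 ((u⁻¹ : Aˣ) * g 0 1) := by
    refine Units.ext ?_
    simp only [Units.val_mul, coe_elemMat_zero, coe_elemMat_one, coe_diagHom, hdet]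
    ext i j
    fin_cases i <;> fin_cases j <;> simp [Matrix.mul_apply, Fin.sum_univ_two]
    · exact hu.symm
    · linear_combination (-g 1 1) * Units.inv_mul u
  rw [hg]
  exact mul_mem (mul_mem (elemMat_mem_GE2 _ _) (diagHom_mem_GE2 _)) (elemMat_mem_GE2 _ _)

theorem elemMat_zero_mul_apply (r : A) (g : GL (Fin 2) A) :
    ((elemMat 0 r * g : GL (Fin 2) A) : Matrix (Fin 2) (Fin 2) A) 0 0 =
      (g : Matrix (Fin 2) (Fin 2) A) 0 0 + r * (g : Matrix (Fin 2) (Fin 2) A) 1 0 ∧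
    ((elemMat 0 r * g : GL (Fin 2) A) : Matrix (Fin 2) (Fin 2) A) 1 0 =
      (g : Matrix (Fin 2) (Fin 2) A) 1 0 := by
  rw [Units.val_mul, coe_elemMat_zero]
  simp [Matrix.mul_apply, Fin.sum_univ_two]

theorem geW_mul_apply (g : GL (Fin 2) A) :
    (((geW : GE2 A) * g : GL (Fin 2) A) : Matrix (Fin 2) (Fin 2) A) 0 0 =
      (g : Matrix (Fin 2) (Fin 2) A) 1 0 ∧
    (((geW : GE2 A) * g : GL (Fin 2) A) : Matrix (Fin 2) (Fin 2) A) 1 0 =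
      -(g : Matrix (Fin 2) (Fin 2) A) 0 0 := by
  rw [Units.val_mul, coe_geW]
  simp [Matrix.mul_apply, Fin.sum_univ_two]

theorem isUnit_col_of_isLocalRing [IsLocalRing A] (g : GL (Fin 2) A) :
    IsUnit ((g : Matrix (Fin 2) (Fin 2) A) 0 0) ∨ IsUnit ((g : Matrix (Fin 2) (Fin 2) A) 1 0) := by
  have h := (GeneralLinearGroup.det g).isUnit
  rw [GeneralLinearGroup.val_det_apply, Matrix.det_fin_two, sub_eq_add_neg] at h
  refine (IsLocalRing.isUnit_or_isUnit_of_isUnit_add h).imp isUnit_of_mul_isUnit_left fun h => ?_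
  exact isUnit_of_mul_isUnit_right ((IsUnit.neg_iff _).1 h)

theorem isGE2Ring_of_isLocalRing [IsLocalRing A] : IsGE2Ring A := by
  refine (Subgroup.eq_top_iff' _).2 fun g => ?_
  rcases isUnit_col_of_isLocalRing g with h | h
  · exact mem_GE2_of_isUnit h
  · refine ((GE2 A).mul_mem_cancel_left (geW : GE2 A).2).1 (mem_GE2_of_isUnit ?_)
    rwa [(geW_mul_apply g).1]

/-- A residue field with more than two elements provides a unit `u` for which `u - 1` is a unit. -/
theorem subsingleton_unitCoinvariants [IsLocalRing A]
    (h : Nat.card (IsLocalRing.ResidueField A) ≠ 2) : Subsingleton (UnitCoinvariants A) := by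
  rw [Ideal.Quotient.subsingleton_iff]
  obtain ⟨k, hk0, hk1⟩ : ∃ k : IsLocalRing.ResidueField A, k ≠ 0 ∧ k ≠ 1 := by
    by_contra! hk
    exact h (Nat.card_eq_two_iff.2 ⟨0, 1, zero_ne_one, Set.eq_univ_of_forall fun k => by
      by_cases h0 : k = 0
      · exact Or.inl h0
      · exact Or.inr (hk k h0)⟩)
  obtain ⟨a, rfl⟩ := IsLocalRing.residue_surjective k
  have ha : IsUnit a := (IsLocalRing.residue_ne_zero_iff_isUnit a).1 hk0
  have ha1 : IsUnit (a - 1) := by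
    rw [← IsLocalRing.residue_ne_zero_iff_isUnit, map_sub, map_one]
    exact sub_ne_zero.2 hk1
  exact Ideal.eq_top_of_isUnit_mem _ (Ideal.subset_span ⟨ha.unit, rfl⟩) ha1

end GE2Rings

/-! ### The integers -/

section Integers

theorem isGE2Ring_int : IsGE2Ring ℤ := by
  refine (Subgroup.eq_top_iff' _).2 fun g => ?_
  induction hn : ((g : Matrix (Fin 2) (Fin 2) ℤ) 1 0).natAbs using Nat.strong_induction_on
    generalizing g with
  | _ n ih =>
    obtain h0 | h0 := eq_or_ne ((g : Matrix (Fin 2) (Fin 2) ℤ) 1 0) 0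
    · refine mem_GE2_of_isUnit ?_
      have h := (GeneralLinearGroup.det g).isUnit
      rw [GeneralLinearGroup.val_det_apply, Matrix.det_fin_two, h0, mul_zero, sub_zero] at h
      exact isUnit_of_mul_isUnit_left h
    · -- One step of the Euclidean algorithm on the first column.
      set a := (g : Matrix (Fin 2) (Fin 2) ℤ) 0 0
      set c := (g : Matrix (Fin 2) (Fin 2) ℤ) 1 0
      let t : GL (Fin 2) ℤ := elemMat 0 (-(a / c))
      have ht : t ∈ GE2 ℤ := elemMat_mem_GE2 _ _
      rw [← (GE2 ℤ).mul_mem_cancel_left ht, ← (GE2 ℤ).mul_mem_cancel_left (geW : GE2 ℤ).2]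
      refine ih _ ?_ _ rfl
      rw [(geW_mul_apply _).2, (elemMat_zero_mul_apply _ g).1, Int.natAbs_neg, ← hn]
      have h1 : a + -(a / c) * c = a % c := by
        linear_combination (-1 : ℤ) * Int.emod_add_mul_ediv a c
      change (a + -(a / c) * c).natAbs < c.natAbs
      rw [h1]
      have := Int.emod_nonneg a h0
      have := Int.emod_lt_abs a h0
      rw [Int.abs_eq_natAbs] at this
      omega

/-- On matrices of determinant one over `𝔽₂` the expression `ab + bc + cd` is additive: it is the
signature of `GL₂(𝔽₂) ≅ S₃`, as it is `1` on the three involutions and `0` elsewhere. -/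
theorem signature_mul : ∀ a b c d a' b' c' d' : ZMod 2, a * d - b * c = 1 → a' * d' - b' * c' = 1 →
    (a * a' + b * c') * (a * b' + b * d') + (a * b' + b * d') * (c * a' + d * c') +
      (c * a' + d * c') * (c * b' + d * d') =
    (a * b + b * c + c * d) + (a' * b' + b' * c' + c' * d') := by
  decide

/-- The composite `GL₂(ℤ) → GL₂(𝔽₂) ≅ S₃ → ℤ/2` of reduction and signature. -/
def intSignature : GL (Fin 2) ℤ →* Multiplicative (ZMod 2) :=
  MonoidHom.mk' (fun g => .ofAdd
    ((g 0 0 : ZMod 2) * (g 0 1 : ZMod 2) + (g 0 1 : ZMod 2) * (g 1 0 : ZMod 2) +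
      (g 1 0 : ZMod 2) * (g 1 1 : ZMod 2))) fun g h => by
    have hdet (g : GL (Fin 2) ℤ) : (g 0 0 : ZMod 2) * g 1 1 - g 0 1 * g 1 0 = 1 := by
      have h1 : ((GeneralLinearGroup.det g : ℤˣ) : ℤ) = g 0 0 * g 1 1 - g 0 1 * g 1 0 := by
        rw [GeneralLinearGroup.val_det_apply, Matrix.det_fin_two]
      have h2 := congrArg (Int.cast : ℤ → ZMod 2) h1
      push_cast at h2
      rw [← h2]
      rcases Int.units_eq_one_or (GeneralLinearGroup.det g) with h | h <;> rw [h] <;> decide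
    rw [← ofAdd_add]
    refine congrArg _ ?_
    rw [← signature_mul _ _ _ _ _ _ _ _ (hdet g) (hdet h)]
    simp only [Units.val_mul, Matrix.mul_apply, Fin.sum_univ_two]
    push_cast
    rfl

/-- The coinvariants `ℤ / ⟨u - 1⟩` form the ring `ℤ / 2`. -/
noncomputable def unitCoinvariantsIntEquiv : UnitCoinvariants ℤ ≃+* ZMod 2 :=
  (Ideal.quotEquivOfEq <| by
    refine le_antisymm (Ideal.span_le.2 ?_) (Ideal.span_le.2 ?_)
    · rintro _ ⟨u, rfl⟩
      rcases Int.units_eq_one_or u with rfl | rfl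
      · simp
      · exact Ideal.mem_span_singleton.2 ⟨-1, rfl⟩
    · rintro _ rfl
      exact (Ideal.neg_mem_iff _).1 (Ideal.subset_span ⟨-1, rfl⟩)).trans
  (Int.quotientSpanNatEquivZMod 2)

theorem nonempty_squareClassGroup_int_equiv :
    Nonempty (Additive (SquareClassGroup ℤ) ≃+ ZMod 2) := by
  have h : (powMonoidHom 2 : ℤˣ →* ℤˣ).range = ⊥ := by
    rw [eq_bot_iff]
    rintro _ ⟨u, rfl⟩
    exact Int.units_sq u
  have e : ℤˣ ≃* Multiplicative (ZMod 2) :=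
    mulEquivOfPrimeCardEq (p := 2) (by simp) (by simp)
  exact ⟨AddEquiv.toMultiplicativeRight.symm
    ((QuotientGroup.quotientMulEquivOfEq h).trans (QuotientGroup.quotientBot.trans e))⟩

theorem nonempty_integralH1_PGL2_int_equiv :
    Nonempty (IntegralH1 (ProjGenLinGroup (Fin 2) ℤ) ≃+ ZMod 2 × ZMod 2) := by
  let l : GE2 ℤ →* Multiplicative (UnitCoinvariants ℤ) :=
    (AddEquiv.toMultiplicative
      unitCoinvariantsIntEquiv.symm.toAddEquiv).toMonoidHom.comp
      (intSignature.comp (GE2 ℤ).subtype)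
  obtain ⟨e⟩ := nonempty_integralH1_PGL2_equiv (l := l) isGE2Ring_int
    (fun r => by
      have h : intSignature (elemMat 0 r) = .ofAdd (r : ZMod 2) := by
        simp [intSignature, coe_elemMat_zero]
      change Multiplicative.ofAdd
        (unitCoinvariantsIntEquiv.symm (intSignature (elemMat 0 r)).toAdd) = _
      rw [h]
      refine congrArg Multiplicative.ofAdd ((RingEquiv.symm_apply_eq _).2 ?_)
      exact (map_intCast (unitCoinvariantsIntEquiv.toRingHom.comp (Ideal.Quotient.mk _)) r).symm)
    (fun q => by
      have h : intSignature (diagHom q) = 1 := by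
        simp [intSignature, coe_diagHom]
      change Multiplicative.ofAdd
        (unitCoinvariantsIntEquiv.symm (intSignature (diagHom q)).toAdd) = _
      rw [h]
      exact congrArg Multiplicative.ofAdd (map_zero unitCoinvariantsIntEquiv.symm))
  obtain ⟨e'⟩ := nonempty_squareClassGroup_int_equiv
  exact ⟨e.trans (e'.prodCongr unitCoinvariantsIntEquiv.toAddEquiv)⟩

end Integers

theorem mainTheorem11 :
    (∀ (A : Type u) [CommRing A], K22GeneratedByDennisStein A →
      Nonempty (IntegralH1 (PGE2 A) ≃+ Additive (SquareClassGroup A) × UnitCoinvariants A)) ∧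
    (∀ (A : Type u) [CommRing A], IsUniversalGE2Ring A →
      Nonempty (IntegralH1 (PGE2 A) ≃+ Additive (SquareClassGroup A) × UnitCoinvariants A) ∧
      Nonempty (IntegralH1 (Matrix.ProjGenLinGroup (Fin 2) A) ≃+
        Additive (SquareClassGroup A) × UnitCoinvariants A)) ∧
    (∀ (A : Type u) [CommRing A] [IsLocalRing A],
      Nat.card (IsLocalRing.ResidueField A) ≠ 2 →
      Nonempty (IntegralH1 (Matrix.ProjGenLinGroup (Fin 2) A) ≃+
        Additive (SquareClassGroup A))) ∧
    Nonempty (IntegralH1 (Matrix.ProjGenLinGroup (Fin 2) ℤ) ≃+ ZMod 2 × ZMod 2) := by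
  refine ⟨fun A _ h => ?_, fun A _ h => ?_, fun A _ _ h => ?_, nonempty_integralH1_PGL2_int_equiv⟩
  · have hK := K22_le_ker_of_dennisStein h
    exact nonempty_integralH1_PGE2_equiv (GE2Coinv_geX hK) (GE2Coinv_geD hK)
  · have hK := K22_le_ker_of_universal h.2
    exact ⟨nonempty_integralH1_PGE2_equiv (GE2Coinv_geX hK) (GE2Coinv_geD hK),
      nonempty_integralH1_PGL2_equiv h.1 (GE2Coinv_geX hK) (GE2Coinv_geD hK)⟩
  · have := subsingleton_unitCoinvariants h
    obtain ⟨e⟩ := nonempty_integralH1_PGL2_equiv (A := A) (l := 1) isGE2Ring_of_isLocalRing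
      (fun r => congrArg Multiplicative.ofAdd (Subsingleton.elim _ _)) (fun _ => rfl)
    exact ⟨e.trans
      { toFun := Prod.fst
        invFun := fun x => (x, 0)
        left_inv := fun _ => Prod.ext rfl (Subsingleton.elim _ _)
        right_inv := fun _ => rfl
        map_add' := fun _ _ => rfl }⟩
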